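/- Let $d\ge 3$ be an integer and let $q>2$ be real. There is a constant $C_{q,d}$, depending only on $q$ and $d$, such that the following holds. Let $\mathcal Z\subset\mathbb R^d$ be a bounded set and let $P$ be a Borel probability measure on $\mathbb R^d$ supported on $\mathcal Z$, i.e. $z\in\mathcal Z$ for $P$-almost every $z$. Let $\mathcal H\subset\mathbb R^k$ be a compact set ($k$ arbitrary), and let $\mathcal F$ be any class of admissible reconstruction maps $f:\mathcal H\to\mathcal Z$, meaning that each $f\in\mathcal F$ is Borel measurable and that $\min_{h\in\mathcal H}\|z-f(h)\|^2$ is attained for every $z\in\mathcal Z$ (here $\|\cdot\|$ is the Euclidean norm). For a Borel probability measure $Q$ on $\mathbb R^d$ put $$\mathcal R(Q,f):=\int \min_{h\in\mathcal H}\|z-f(h)\|^2\,Q(\mathrm dz).$$ Let $n\ge 1$, let $Z_1,\dots,Z_n$ be independent random vectors with common law $P$, and let $P_n=\frac1n\sum_{i=1}^n\delta_{Z_i}$ be their empirical distribution. Then for every $\delta\in(0,1)$, with probability at least $1-\delta$, $$\sup_{f\in\mathcal F}\bigl|\mathcal R(P,f)-\mathcal R(P_n,f)\bigr|\;\le\;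 C_{q,d}\,\operatorname{diam}(\mathcal Z)\Bigl(\int_{\mathcal Z}\|z\|^q\,P(\mathrm dz)\Bigr)^{1/q} n^{-1/d}+\operatorname{diam}(\mathcal Z)^2\sqrt{\frac{2\log(1/\delta)}{n}}.$$ -/

import Mathlib

open MeasureTheory ProbabilityTheory
open scoped ENNReal

noncomputable section

namespace CodingScheme

/-- The reconstruction map `f : H → ℝ^d` on the latent space `H` is admissible for the data
set `Z`: it is Borel measurable, takes its values in `Z`, and the minimum over `h ∈ H` of the
reconstruction error `‖z - f h‖²` is attained for every data point `z ∈ Z`. -/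
structure IsAdmissible {k d : ℕ} (H : Set (EuclideanSpace ℝ (Fin k)))
    (Z : Set (EuclideanSpace ℝ (Fin d))) (f : H → EuclideanSpace ℝ (Fin d)) : Prop where
  measurable : Measurable f
  mem : ∀ h, f h ∈ Z
  exists_min : ∀ z ∈ Z, ∃ h, ∀ h', ‖z - f h‖ ^ 2 ≤ ‖z - f h'‖ ^ 2

/-- The minimal reconstruction error `e_f(z) = min_{h ∈ H} ‖z - f h‖²` (the infimum, which for an
admissible `f` is a minimum at every data point). -/
def minError {k d : ℕ} {H : Set (EuclideanSpace ℝ (Fin k))}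
    (f : H → EuclideanSpace ℝ (Fin d)) (z : EuclideanSpace ℝ (Fin d)) : ℝ :=
  ⨅ h : H, ‖z - f h‖ ^ 2

/-- The expected reconstruction error `R(P, f) = E_P[e_f(Z)]`. For an admissible `f` the function
`e_f` is continuous, and it is bounded on `Z`, so it is integrable for every probability measure
carried by a bounded set `Z`. -/
def risk {k d : ℕ} {H : Set (EuclideanSpace ℝ (Fin k))}
    (P : Measure (EuclideanSpace ℝ (Fin d))) (f : H → EuclideanSpace ℝ (Fin d)) : ℝ :=
  ∫ z, minError f z ∂P

/-- The empirical distribution `P_n = (1/n) ∑ δ_{z_i}` of the points `z_1, …, z_n`. -/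
def empiricalDist {d n : ℕ} (z : Fin n → EuclideanSpace ℝ (Fin d)) :
    Measure (EuclideanSpace ℝ (Fin d)) :=
  (n : ℝ≥0∞)⁻¹ • ∑ i, Measure.dirac (z i)

/-- The generalization error `sup_{f ∈ F} |R(P, f) - R(P_n, f)|` on the sample `z_1, …, z_n`,
a supremum of nonnegative numbers taken in `[0, ∞]`. -/
def genError {k d n : ℕ} {H : Set (EuclideanSpace ℝ (Fin k))}
    (P : Measure (EuclideanSpace ℝ (Fin d))) (F : Set (H → EuclideanSpace ℝ (Fin d)))
    (z : Fin n → EuclideanSpace ℝ (Fin d)) : ℝ≥0∞ :=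
  ⨆ f ∈ F, ENNReal.ofReal |risk P f - risk (empiricalDist z) f|

end CodingScheme

end

noncomputable section

namespace CodingScheme

/-! On `Z` each error `minError f` is Lipschitz with constant `2 * diam Z` and has values in `[0,
diam Z ^ 2]`. It therefore agrees there with a member of one fixed class of bounded Lipschitz
functions on the whole space (`IsAdmissible.exists_mem_lipClass`). So the generalization error is at
most `deviation`, the worst gap between mean and empirical mean over that class, whatever `F`, `H`
and `k` are.

Changing one sample point moves `deviation` by at most `diam Z ^ 2 / n`, so bounded differences
concentrate it around its mean and give the second term of the bound.

The mean is a transport estimate. Space is cut into dyadic shells of radius `2 ^ j * M`, with `M`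
just above the `q`-th moment norm, and shell `j` is cut into cubes of side `2 ^ j * M / 2 ^ l`.
Telescoping a Lipschitz function along the corners of these nested cubes bounds its deviation by
side length times discrepancy of cube masses, summed over levels `l ≤ N`, plus a remainder of order
`2 ^ (-N)` (`abs_integral_sub_integral_le`). The expected discrepancy of a cube `A` is at most `√(P
A / n)`. By Cauchy–Schwarz over the cubes of a shell, level `l` costs a multiple of `(2 ^ (d / 2) /
2) ^ l / √n` times the sum of `2 ^ j * √(P (shell j))`. Markov's inequality makes that sum bounded
exactly because `q > 2`. Since `d ≥ 3`, the series in `l` grows geometrically, so its last term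
dominates, and `2 ^ N ≈ n ^ (1 / d)` balances it with the remainder (`exists_level`). -/

/-! ### Concentration by bounded differences -/

/-- McDiarmid's inequality: a bounded measurable function of `n` independent variables that changes
by at most `c` when one variable changes is sub-Gaussian around its mean. -/
theorem hasSubgaussianMGF_of_bounded_differences {E : Type*} [MeasurableSpace E] (P : Measure E)
    [IsProbabilityMeasure P] (c : NNReal) (B : ℝ) (n : ℕ) (T : (Fin n → E) → ℝ)
    (hT : Measurable T) (hB : ∀ x, ‖T x‖ ≤ B)
    (hc : ∀ i x y, |T (Function.update x i y) - T x| ≤ c) :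
    HasSubgaussianMGF (fun x => T x - ∫ y, T y ∂Measure.pi fun _ => P) (n * (c / 2) ^ 2)
      (Measure.pi fun _ => P) := by
  have hint : ∀ (n : ℕ) (T : (Fin n → E) → ℝ), Measurable T → (∀ x, ‖T x‖ ≤ B) → ∀ s b : ℝ,
      Integrable (fun x => Real.exp (s * (T x - b))) (Measure.pi fun _ : Fin n => P) := by
    intro n T hT hB s b
    refine Integrable.of_bound (by fun_prop) (Real.exp (|s| * (B + |b|))) (.of_forall fun x => ?_)
    rw [Real.norm_eq_abs, Real.abs_exp, Real.exp_le_exp]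
    calc s * (T x - b) ≤ |s * (T x - b)| := le_abs_self _
      _ = |s| * |T x - b| := abs_mul _ _
      _ ≤ |s| * (B + |b|) := by
        gcongr
        exact (abs_sub _ _).trans (by gcongr; exact hB x)
  refine ⟨fun s => hint n T hT hB s _, fun s => ?_⟩
  induction n with
  | zero =>
    have : ∀ x, T x = T Fin.elim0 := fun x => by congr 1; exact Subsingleton.elim _ _
    simp [mgf, this]
  | succ n ih =>
    -- Split off the first coordinate `a`. With `m a` the mean over the remaining ones, `T - t = (S
    -- a x - m a) + (m a - t)`: the induction hypothesis controls the first summand for each fixed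
    -- `a`, Hoeffding's lemma the second.
    set ν : Measure (Fin n → E) := Measure.pi fun _ => P
    let e := MeasurableEquiv.piFinSuccAbove (fun _ : Fin (n + 1) => E) 0
    have he : MeasurePreserving e.symm (P.prod ν) (Measure.pi fun _ => P) :=
      (measurePreserving_piFinSuccAbove (fun _ : Fin (n + 1) => P) 0).symm
    have hes : ∀ p, e.symm p = Fin.cons p.1 p.2 := fun p => by
      simp [e, MeasurableEquiv.piFinSuccAbove, Fin.insertNthEquiv]
    set S : E → (Fin n → E) → ℝ := fun a x => T (Fin.cons a x) with hS
    have hSm : Measurable (Function.uncurry S) := by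
      have : Function.uncurry S = T ∘ e.symm := by
        ext p; simp [S, hes, Function.uncurry]
      rw [this]; exact hT.comp e.symm.measurable
    have hSa : ∀ a, Measurable (S a) := fun a => hSm.comp measurable_prodMk_left
    have hSi : ∀ a, Integrable (S a) ν := fun a =>
      Integrable.of_bound (hSa a).aestronglyMeasurable B (.of_forall fun x => hB _)
    set m : E → ℝ := fun a => ∫ x, S a x ∂ν with hm
    have hmm : Measurable m :=
      (StronglyMeasurable.integral_prod_right' hSm.stronglyMeasurable).measurable
    have hmd : ∀ a a', |m a - m a'| ≤ c := fun a a' => by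
      rw [← integral_sub (hSi a) (hSi a'), ← Real.norm_eq_abs]
      refine (norm_integral_le_of_norm_le_const (C := c) (.of_forall fun x => ?_)).trans (by simp)
      have := hc 0 (Fin.cons a' x) a
      rwa [Fin.update_cons_zero] at this
    have hTm : ∫ y, T y ∂(Measure.pi fun _ => P) = ∫ a, m a ∂P := by
      rw [← he.integral_comp e.symm.measurableEmbedding]
      simp_rw [hes]
      refine integral_prod (fun p => S p.1 p.2) ?_
      exact Integrable.of_bound hSm.aestronglyMeasurable B (.of_forall fun x => hB _)
    set t := ∫ a, m a ∂P with ht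
    have hinner : ∀ a, ∫ x, Real.exp (s * (S a x - m a)) ∂ν ≤
        Real.exp (((n * (c / 2) ^ 2 : NNReal) : ℝ) * s ^ 2 / 2) := fun a => by
      refine ih (S a) (hSa a) (fun x => hB _) fun i x y => ?_
      have := hc i.succ (Fin.cons a x) y
      rwa [← Fin.cons_update] at this
    have houter : ∫ a, Real.exp (s * (m a - t)) ∂P ≤
        Real.exp ((((c / 2) ^ 2 : NNReal) : ℝ) * s ^ 2 / 2) := by
      obtain ⟨a₀⟩ : Nonempty E := nonempty_of_isProbabilityMeasure P
      have hbdd : BddBelow (Set.range m) := ⟨m a₀ - c, by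
        rintro _ ⟨a, rfl⟩
        have := abs_le.1 (hmd a₀ a)
        linarith⟩
      have : Nonempty E := ⟨a₀⟩
      -- Any two values of `m` differ by at most `c`, so its range lies in an interval of length `c`
      -- starting at its infimum.
      have h := hasSubgaussianMGF_of_mem_Icc (μ := P) (X := m) (a := ⨅ a, m a)
        (b := (⨅ a, m a) + c) hmm.aemeasurable (.of_forall fun a => ⟨ciInf_le hbdd a, by
          have : m a - c ≤ ⨅ a, m a := le_ciInf fun a' => by
            have := abs_le.1 (hmd a a')
            linarith
          linarith⟩)
      simpa [mgf] using h.mgf_le s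
    have hexp : ∫ x, Real.exp (s * (T x - t)) ∂(Measure.pi fun _ => P) =
        ∫ a, Real.exp (s * (m a - t)) * ∫ x, Real.exp (s * (S a x - m a)) ∂ν ∂P := by
      rw [← he.integral_comp e.symm.measurableEmbedding]
      simp_rw [hes]
      rw [integral_prod (fun p : E × (Fin n → E) => Real.exp (s * (S p.1 p.2 - t)))]
      · refine integral_congr_ae (.of_forall fun a => ?_)
        simp only
        rw [← integral_const_mul]
        refine integral_congr_ae (.of_forall fun x => ?_)
        simp only
        rw [← Real.exp_add]
        congr 1; ring
      · have := he.integrable_comp_of_integrable (hint (n + 1) T hT hB s t)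
        refine this.congr (.of_forall fun p => ?_)
        simp [hes, S]
    rw [mgf, hTm, hexp]
    have hmi : Integrable (fun a => Real.exp (s * (m a - t))) P := by
      have hm1 : ∀ a, ‖m a‖ ≤ B := fun a =>
        (norm_integral_le_of_norm_le_const (.of_forall fun x => hB _)).trans (by simp)
      refine Integrable.of_bound (by fun_prop) (Real.exp (|s| * (B + |t|)))
        (.of_forall fun x => ?_)
      rw [Real.norm_eq_abs, Real.abs_exp, Real.exp_le_exp]
      calc s * (m x - t) ≤ |s * (m x - t)| := le_abs_self _
        _ = |s| * |m x - t| := abs_mul _ _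
        _ ≤ |s| * (B + |t|) := by
          gcongr
          exact (abs_sub _ _).trans (by gcongr; exact hm1 x)
    calc _ ≤ ∫ a, Real.exp (s * (m a - t)) *
          Real.exp (((n * (c / 2) ^ 2 : NNReal) : ℝ) * s ^ 2 / 2) ∂P := by
          refine integral_mono_of_nonneg (.of_forall fun a => by positivity)
            (hmi.mul_const _) (.of_forall fun a => ?_)
          exact mul_le_mul_of_nonneg_left (hinner a) (by positivity)
      _ ≤ Real.exp ((((c / 2) ^ 2 : NNReal) : ℝ) * s ^ 2 / 2) *
          Real.exp (((n * (c / 2) ^ 2 : NNReal) : ℝ) * s ^ 2 / 2) := by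
          rw [integral_mul_const]; gcongr
      _ = _ := by
          rw [← Real.exp_add]; congr 1; push_cast; ring

/-! ### Multiscale dyadic cells -/

/-- The index `j` of the dyadic shell `2 ^ (j - 1) * M < ‖z‖ ≤ 2 ^ j * M` that contains `z`. -/
def shell {d : ℕ} (M : ℝ) (z : EuclideanSpace ℝ (Fin d)) : ℕ := Nat.clog 2 ⌈‖z‖ / M⌉₊

/-- The label of the cube that contains `z` when its shell is cut into cubes of side length
`2 ^ j * M / 2 ^ l`. -/
def cell {d : ℕ} (M : ℝ) (l : ℕ) (z : EuclideanSpace ℝ (Fin d)) : ℕ × (Fin d → ℤ) :=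
  (shell M z, fun i => ⌊z i / (2 ^ shell M z * M) * 2 ^ l⌋)

/-- The corner of the cube with a given label. -/
def corner {d : ℕ} (M : ℝ) (l : ℕ) (a : ℕ × (Fin d → ℤ)) : EuclideanSpace ℝ (Fin d) :=
  WithLp.toLp 2 fun i => 2 ^ a.1 * M / 2 ^ l * a.2 i

/-- The label of the cube of the previous level that contains a given cube. -/
def parent {d : ℕ} (a : ℕ × (Fin d → ℤ)) : ℕ × (Fin d → ℤ) := (a.1, fun i => a.2 i / 2)

/-- The labels of the cubes of level `l` that meet the ball of radius `2 ^ J * M`. -/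
def cells (d J l : ℕ) : Finset (ℕ × (Fin d → ℤ)) :=
  Finset.range (J + 1) ×ˢ Fintype.piFinset fun _ => Finset.Icc (-2 ^ l) (2 ^ l)

lemma norm_le_of_forall_abs_le {d : ℕ} {x : EuclideanSpace ℝ (Fin d)} {b : ℝ} (hb : 0 ≤ b)
    (h : ∀ i, |x i| ≤ b) : ‖x‖ ≤ d * b := by
  rw [EuclideanSpace.norm_eq]
  refine Real.sqrt_le_iff.2 ⟨by positivity, ?_⟩
  calc ∑ i, ‖x i‖ ^ 2 ≤ ∑ _i : Fin d, b ^ 2 :=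
        Finset.sum_le_sum fun i _ => by
          have := h i
          rw [Real.norm_eq_abs]; gcongr
    _ = d * b ^ 2 := by simp
    _ ≤ (d : ℝ) ^ 2 * b ^ 2 := by
        gcongr
        exact_mod_cast Nat.le_self_pow two_ne_zero d
    _ = _ := by ring

/-- Since `Nat.clog 2` vanishes at `0` and `1`, shell `0` is the whole ball of radius `M`, so the
shells cover the origin too. -/
lemma shell_le_iff {d : ℕ} {M : ℝ} (hM : 0 < M) {z : EuclideanSpace ℝ (Fin d)} {j : ℕ} :
    shell M z ≤ j ↔ ‖z‖ ≤ 2 ^ j * M := by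
  rw [shell, Nat.clog_le_iff_le_pow one_lt_two, Nat.ceil_le, div_le_iff₀ hM]
  push_cast; rfl

lemma norm_le_shell {d : ℕ} {M : ℝ} (hM : 0 < M) (z : EuclideanSpace ℝ (Fin d)) :
    ‖z‖ ≤ 2 ^ shell M z * M := (shell_le_iff hM).1 le_rfl

lemma two_pow_shell_le {d : ℕ} {M : ℝ} (hM : 0 < M) (z : EuclideanSpace ℝ (Fin d)) :
    2 ^ shell M z * M ≤ M + 2 * ‖z‖ := by
  rcases h : shell M z with _ | j
  · simp
  · have : ¬ shell M z ≤ j := by omega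
    rw [shell_le_iff hM] at this
    rw [pow_succ]; linarith

@[fun_prop]
lemma measurable_shell {d : ℕ} (M : ℝ) :
    Measurable (shell M : EuclideanSpace ℝ (Fin d) → ℕ) :=
  (measurable_from_nat (f := Nat.clog 2)).comp (Nat.measurable_ceil.comp (by fun_prop))

@[fun_prop]
lemma measurable_cell {d : ℕ} (M : ℝ) (l : ℕ) :
    Measurable (cell M l : EuclideanSpace ℝ (Fin d) → ℕ × (Fin d → ℤ)) := by
  refine (measurable_shell M).prodMk (measurable_pi_lambda _ fun i => Int.measurable_floor.comp ?_)
  have : Measurable fun z : EuclideanSpace ℝ (Fin d) => (2 : ℝ) ^ shell M z :=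
    (measurable_from_nat (f := fun n => (2 : ℝ) ^ n)).comp (measurable_shell M)
  fun_prop

lemma parent_cell {d : ℕ} (M : ℝ) (l : ℕ) (z : EuclideanSpace ℝ (Fin d)) :
    parent (cell M (l + 1) z) = cell M l z := by
  refine Prod.ext rfl (funext fun i => ?_)
  have := Int.floor_div_natCast (z i / (2 ^ shell M z * M) * 2 ^ (l + 1)) 2
  simp only [parent, cell]
  push_cast at this
  rw [← this, pow_succ]
  congr 1; ring

/-- Rescaled coordinates lie in the closed interval `[-1, 1]`, so the label `2 ^ l` does occur and
both endpoints belong to `cells`. -/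
lemma cell_mem_cells {d : ℕ} {M : ℝ} (hM : 0 < M) (J l : ℕ) {z : EuclideanSpace ℝ (Fin d)}
    (hz : ‖z‖ ≤ 2 ^ J * M) : cell M l z ∈ cells d J l := by
  simp only [cells, cell, Finset.mem_product, Finset.mem_range, Fintype.mem_piFinset,
    Finset.mem_Icc, Nat.lt_succ_iff]
  refine ⟨(shell_le_iff hM).2 hz, fun i => ?_⟩
  have hr : 0 < 2 ^ shell M z * M := by positivity
  have h1 : |z i / (2 ^ shell M z * M)| ≤ 1 := by
    rw [abs_div, abs_of_pos hr, div_le_one hr]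
    exact (PiLp.norm_apply_le z i).trans (norm_le_shell hM z)
  obtain ⟨h2, h3⟩ := abs_le.1 h1
  have h4 : (0 : ℝ) < 2 ^ l := by positivity
  constructor
  · rw [Int.le_floor]; push_cast; nlinarith
  · have : (⌊z i / (2 ^ shell M z * M) * 2 ^ l⌋ : ℝ) ≤ 2 ^ l :=
      (Int.floor_le _).trans (by nlinarith)
    exact (Int.cast_le (R := ℝ)).1 (by push_cast; exact this)

lemma norm_sub_corner_le {d : ℕ} {M : ℝ} (hM : 0 < M) (l : ℕ) (z : EuclideanSpace ℝ (Fin d)) :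
    ‖z - corner M l (cell M l z)‖ ≤ d * (2 ^ shell M z * M / 2 ^ l) := by
  refine norm_le_of_forall_abs_le (by positivity) fun i => ?_
  have hr : 0 < 2 ^ shell M z * M := by positivity
  set x := z i / (2 ^ shell M z * M) * 2 ^ l with hx
  have : (z - corner M l (cell M l z)) i = 2 ^ shell M z * M / 2 ^ l * (x - ⌊x⌋) := by
    simp only [corner, cell, PiLp.sub_apply, hx]
    field_simp
  rw [this, abs_mul, abs_of_pos (by positivity)]
  refine mul_le_of_le_one_right (by positivity) ?_
  rw [abs_le]
  constructor <;> linarith [Int.floor_le x, Int.lt_floor_add_one x]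

lemma norm_corner_zero_le {d : ℕ} {M : ℝ} (hM : 0 < M) {J : ℕ} {a : ℕ × (Fin d → ℤ)}
    (ha : a ∈ cells d J 0) : ‖corner M 0 a‖ ≤ d * (2 ^ a.1 * M / 2 ^ 0) := by
  refine norm_le_of_forall_abs_le (by positivity) fun i => ?_
  simp only [cells, Finset.mem_product, Fintype.mem_piFinset, Finset.mem_Icc, pow_zero] at ha
  have : |(a.2 i : ℝ)| ≤ 1 := by exact_mod_cast abs_le.2 (ha.2 i)
  simp only [corner]
  rw [abs_mul, abs_of_pos (by positivity)]
  exact mul_le_of_le_one_right (by positivity) this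

/-- Halving an integer label leaves remainder `0` or `1`, so the two corners differ by at most one
fine side length in each coordinate. -/
lemma norm_corner_succ_sub_le {d : ℕ} {M : ℝ} (hM : 0 < M) (l : ℕ) (a : ℕ × (Fin d → ℤ)) :
    ‖corner M (l + 1) a - corner M l (parent a)‖ ≤ d * (2 ^ a.1 * M / 2 ^ (l + 1)) := by
  refine norm_le_of_forall_abs_le (by positivity) fun i => ?_
  have h : (a.2 i : ℝ) = 2 * (a.2 i / 2 : ℤ) + (a.2 i % 2 : ℤ) := by
    exact_mod_cast (Int.mul_ediv_add_emod (a.2 i) 2).symm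
  have : (corner M (l + 1) a - corner M l (parent a)) i =
      2 ^ a.1 * M / 2 ^ (l + 1) * (a.2 i % 2 : ℤ) := by
    simp only [corner, parent, PiLp.sub_apply]
    rw [h, pow_succ]
    field_simp
    ring
  rw [this, abs_mul, abs_of_pos (by positivity)]
  refine mul_le_of_le_one_right (by positivity) ?_
  have h1 : |a.2 i % 2| ≤ 1 := by
    rw [abs_le]; omega
  rw [← Int.cast_abs, ← Int.cast_one, Int.cast_le]
  exact h1

lemma integrable_comp_and_integral_eq_sum {Ω A : Type*} [MeasurableSpace Ω] [MeasurableSpace A]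
    [MeasurableSingletonClass A] {P : Measure Ω} [IsFiniteMeasure P] {c : Ω → A}
    (hc : Measurable c) {S : Finset A} (hS : ∀ᵐ z ∂P, c z ∈ S) (ψ : A → ℝ) :
    Integrable (fun z => ψ (c z)) P ∧
      ∫ z, ψ (c z) ∂P = ∑ a ∈ S, P.real (c ⁻¹' {a}) * ψ a := by
  classical
  have hm : ∀ a, MeasurableSet (c ⁻¹' {a}) := fun a => hc (measurableSet_singleton a)
  have h : (fun z => ψ (c z)) =ᵐ[P] fun z => ∑ a ∈ S, (c ⁻¹' {a}).indicator (fun _ => ψ a) z := by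
    filter_upwards [hS] with z hz
    rw [Finset.sum_eq_single_of_mem (c z) hz]
    · simp
    · intro b _ hb
      simp [Set.indicator, hb.symm]
  have hi : ∀ a ∈ S, Integrable ((c ⁻¹' {a}).indicator fun _ => ψ a) P := fun a _ =>
    (integrable_const _).indicator (hm a)
  refine ⟨(integrable_finsetSum S hi).congr h.symm, ?_⟩
  rw [integral_congr_ae h, integral_finsetSum S hi]
  exact Finset.sum_congr rfl fun a _ => by rw [integral_indicator_const _ (hm a)]; simp

/-- A function of the cell label sees a measure only through its cell masses, so the weighted
discrepancy of these masses controls the difference of integrals. -/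
lemma abs_integral_comp_sub_le {Ω A : Type*} [MeasurableSpace Ω] [MeasurableSpace A]
    [MeasurableSingletonClass A] {P ν : Measure Ω} [IsFiniteMeasure P] [IsFiniteMeasure ν]
    {c : Ω → A} (hc : Measurable c) {S : Finset A} (hP : ∀ᵐ z ∂P, c z ∈ S)
    (hν : ∀ᵐ z ∂ν, c z ∈ S) {ψ w : A → ℝ} (hw : ∀ a ∈ S, |ψ a| ≤ w a) :
    |∫ z, ψ (c z) ∂P - ∫ z, ψ (c z) ∂ν| ≤
      ∑ a ∈ S, w a * |P.real (c ⁻¹' {a}) - ν.real (c ⁻¹' {a})| := by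
  rw [(integrable_comp_and_integral_eq_sum hc hP ψ).2,
    (integrable_comp_and_integral_eq_sum hc hν ψ).2, ← Finset.sum_sub_distrib]
  refine (Finset.abs_sum_le_sum_abs _ _).trans (Finset.sum_le_sum fun a ha => ?_)
  rw [← sub_mul, abs_mul, mul_comm]
  gcongr
  exact hw a ha

/-- The sum over all cells up to level `N` that bounds the transport distance of two measures. -/
def cellSum {d : ℕ} (M : ℝ) (J N : ℕ) (P ν : Measure (EuclideanSpace ℝ (Fin d))) : ℝ :=
  ∑ l ∈ Finset.range (N + 1), ∑ a ∈ cells d J l, d * (2 ^ a.1 * M / 2 ^ l) *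
    |P.real (cell M l ⁻¹' {a}) - ν.real (cell M l ⁻¹' {a})|

lemma integrable_two_pow_shell {d : ℕ} {M : ℝ} (hM : 0 < M) {J : ℕ}
    {P : Measure (EuclideanSpace ℝ (Fin d))} [IsFiniteMeasure P] (hP : ∀ᵐ z ∂P, ‖z‖ ≤ 2 ^ J * M) :
    Integrable (fun z => 2 ^ shell M z * M) P :=
  (integrable_comp_and_integral_eq_sum (ψ := fun j => 2 ^ j * M) (measurable_shell M)
    (S := Finset.range (J + 1)) (by
      filter_upwards [hP] with z hz
      exact Finset.mem_range_succ_iff.2 ((shell_le_iff hM).2 hz))).1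

/-- Two probability measures on a ball, tested against a Lipschitz function: the multiscale
bound. -/
theorem abs_integral_sub_integral_le {d : ℕ} {M : ℝ} (hM : 0 < M) {J : ℕ} (N : ℕ)
    {P ν : Measure (EuclideanSpace ℝ (Fin d))} [IsProbabilityMeasure P] [IsProbabilityMeasure ν]
    (hP : ∀ᵐ z ∂P, ‖z‖ ≤ 2 ^ J * M) (hν : ∀ᵐ z ∂ν, ‖z‖ ≤ 2 ^ J * M)
    {g : EuclideanSpace ℝ (Fin d) → ℝ} {K : NNReal} (hg : LipschitzWith K g) :
    |∫ z, g z ∂P - ∫ z, g z ∂ν| ≤ K * (d / 2 ^ N *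
      (∫ z, 2 ^ shell M z * M ∂P + ∫ z, 2 ^ shell M z * M ∂ν) + cellSum M J N P ν) := by
  have hPc : ∀ l, ∀ᵐ z ∂P, cell M l z ∈ cells d J l := fun l =>
    hP.mono fun z hz => cell_mem_cells hM J l hz
  have hνc : ∀ l, ∀ᵐ z ∂ν, cell M l z ∈ cells d J l := fun l =>
    hν.mono fun z hz => cell_mem_cells hM J l hz
  have iP : ∀ l (ψ : ℕ × (Fin d → ℤ) → ℝ), Integrable (fun z => ψ (cell M l z)) P := fun l ψ =>
    (integrable_comp_and_integral_eq_sum (measurable_cell M l) (hPc l) ψ).1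
  have iν : ∀ l (ψ : ℕ × (Fin d → ℤ) → ℝ), Integrable (fun z => ψ (cell M l z)) ν := fun l ψ =>
    (integrable_comp_and_integral_eq_sum (measurable_cell M l) (hνc l) ψ).1
  have hgn : ∀ x y, |g x - g y| ≤ K * ‖x - y‖ := fun x y => by
    have := hg.dist_le_mul x y
    rwa [Real.dist_eq, dist_eq_norm] at this
  have key : ∀ N, |∫ z, g (corner M N (cell M N z)) ∂P - ∫ z, g (corner M N (cell M N z)) ∂ν| ≤
      K * cellSum M J N P ν := by
    intro N
    induction N with
    | zero =>
      -- Both measures have mass one, so subtracting the constant `g 0` changes nothing, and the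
      -- Lipschitz bound then applies to `g (corner) - g 0`.
      have h := abs_integral_comp_sub_le (measurable_cell M 0) (hPc 0) (hνc 0)
        (ψ := fun a => g (corner M 0 a) - g 0) (w := fun a => K * (d * (2 ^ a.1 * M / 2 ^ 0)))
        (fun a ha => (hgn _ _).trans (by
          rw [sub_zero]; gcongr; exact norm_corner_zero_le hM ha))
      rw [integral_sub (iP 0 fun a => g (corner M 0 a)) (integrable_const _),
        integral_sub (iν 0 fun a => g (corner M 0 a)) (integrable_const _)] at h
      simp only [integral_const, probReal_univ, one_smul, sub_sub_sub_cancel_right] at h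
      refine h.trans_eq ?_
      simp only [cellSum, Finset.sum_range_one, Finset.mul_sum, zero_add, mul_assoc]
    | succ N ih =>
      -- One telescoping step: the increment from the parent's corner is a function of the finer
      -- label, and `parent_cell` identifies the subtracted part with level `N`.
      have h := abs_integral_comp_sub_le (measurable_cell M (N + 1)) (hPc (N + 1)) (hνc (N + 1))
        (ψ := fun a => g (corner M (N + 1) a) - g (corner M N (parent a)))
        (w := fun a => K * (d * (2 ^ a.1 * M / 2 ^ (N + 1))))
        (fun a ha => (hgn _ _).trans (by gcongr; exact norm_corner_succ_sub_le hM N a))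
      rw [integral_sub (iP (N + 1) fun a => g (corner M (N + 1) a))
          (iP (N + 1) fun a => g (corner M N (parent a))),
        integral_sub (iν (N + 1) fun a => g (corner M (N + 1) a))
          (iν (N + 1) fun a => g (corner M N (parent a)))] at h
      simp only [parent_cell] at h
      have hs : K * cellSum M J (N + 1) P ν = K * cellSum M J N P ν +
          ∑ a ∈ cells d J (N + 1), K * (d * (2 ^ a.1 * M / 2 ^ (N + 1))) *
            |P.real (cell M (N + 1) ⁻¹' {a}) - ν.real (cell M (N + 1) ⁻¹' {a})| := by
        simp only [cellSum, Finset.sum_range_succ _ (N + 1), mul_add, Finset.mul_sum, mul_assoc]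
      rw [hs]
      rw [abs_le] at h ih ⊢
      constructor <;> linarith [h.1, h.2, ih.1, ih.2]
  -- The error of replacing each point by its level-`N` corner.
  have hrest : ∀ (Q : Measure (EuclideanSpace ℝ (Fin d))) [IsProbabilityMeasure Q],
      (∀ᵐ z ∂Q, ‖z‖ ≤ 2 ^ J * M) → Integrable (fun z => g (corner M N (cell M N z))) Q →
      |∫ z, g z ∂Q - ∫ z, g (corner M N (cell M N z)) ∂Q| ≤
        K * (d / 2 ^ N * ∫ z, 2 ^ shell M z * M ∂Q) := by
    intro Q _ hQ hQi
    have hgi : Integrable g Q := by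
      refine Integrable.of_bound hg.continuous.aestronglyMeasurable (|g 0| + K * (2 ^ J * M)) ?_
      filter_upwards [hQ] with z hz
      have h1 := hgn z 0
      rw [sub_zero] at h1
      have h2 := abs_sub_abs_le_abs_sub (g z) (g 0)
      have h3 : K * ‖z‖ ≤ K * (2 ^ J * M) := by gcongr
      rw [Real.norm_eq_abs]; linarith
    rw [← integral_sub hgi hQi, ← Real.norm_eq_abs, ← mul_assoc, ← integral_const_mul]
    refine norm_integral_le_of_norm_le ((integrable_two_pow_shell hM hQ).const_mul _)
      (.of_forall fun z => ?_)
    refine (hgn _ _).trans ?_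
    calc K * ‖z - corner M N (cell M N z)‖ ≤ K * (d * (2 ^ shell M z * M / 2 ^ N)) := by
          gcongr; exact norm_sub_corner_le hM N z
      _ = _ := by ring
  have h1 := abs_le.1 (hrest P hP (iP N fun a => g (corner M N a)))
  have h2 := abs_le.1 (hrest ν hν (iν N fun a => g (corner M N a)))
  have h3 := abs_le.1 (key N)
  rw [mul_add, mul_add, mul_add, abs_le]
  constructor <;> linarith [h1.1, h1.2, h2.1, h2.2, h3.1, h3.2]

/-! ### Empirical measures -/

lemma integral_empiricalDist {d n : ℕ} (z : Fin n → EuclideanSpace ℝ (Fin d))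
    (f : EuclideanSpace ℝ (Fin d) → ℝ) :
    ∫ x, f x ∂empiricalDist z = (∑ i, f (z i)) / n := by
  rw [empiricalDist, integral_smul_measure, integral_finsetSum_measure]
  · simp [integral_dirac, div_eq_inv_mul]
  · exact fun i _ => integrable_dirac (by simp)

lemma ae_empiricalDist {d n : ℕ} {z : Fin n → EuclideanSpace ℝ (Fin d)}
    {p : EuclideanSpace ℝ (Fin d) → Prop} (h : ∀ i, p (z i)) : ∀ᵐ x ∂empiricalDist z, p x := by
  refine Measure.ae_smul_measure ?_ _
  rw [ae_finsetSum_measure_iff]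
  intro i _
  rw [ae_dirac_eq]
  exact h i

lemma isProbabilityMeasure_empiricalDist {d n : ℕ} (hn : n ≠ 0)
    (z : Fin n → EuclideanSpace ℝ (Fin d)) : IsProbabilityMeasure (empiricalDist z) :=
  ⟨by simp [empiricalDist, ENNReal.inv_mul_cancel, hn]⟩

lemma real_empiricalDist {d n : ℕ} (z : Fin n → EuclideanSpace ℝ (Fin d))
    {A : Set (EuclideanSpace ℝ (Fin d))} (hA : MeasurableSet A) :
    (empiricalDist z).real A = (∑ i, A.indicator 1 (z i)) / n := by
  rw [← integral_empiricalDist, integral_indicator_one hA]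

/-- This is nonnegativity of the variance of `|X|`. -/
lemma integral_abs_le_sqrt_integral_sq {Ω : Type*} [MeasurableSpace Ω] {μ : Measure Ω}
    [IsProbabilityMeasure μ] {X : Ω → ℝ} (hX : MemLp X 2 μ) :
    ∫ ω, |X ω| ∂μ ≤ Real.sqrt (∫ ω, X ω ^ 2 ∂μ) := by
  refine Real.le_sqrt_of_sq_le ?_
  have h := variance_nonneg |X| μ
  rw [variance_eq_sub hX.abs] at h
  simpa using h

lemma measurable_real_empiricalDist {d n : ℕ} {A : Set (EuclideanSpace ℝ (Fin d))}
    (hA : MeasurableSet A) :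
    Measurable fun z : Fin n → EuclideanSpace ℝ (Fin d) => (empiricalDist z).real A := by
  simp_rw [real_empiricalDist _ hA]
  refine (Finset.measurable_sum _ fun i _ => ?_).div_const _
  exact (measurable_one.indicator hA).comp (measurable_pi_apply i)

lemma integrable_abs_sub_real_empiricalDist {d n : ℕ} (hn : n ≠ 0)
    (P : Measure (EuclideanSpace ℝ (Fin d))) [IsProbabilityMeasure P]
    {A : Set (EuclideanSpace ℝ (Fin d))} (hA : MeasurableSet A) :
    Integrable (fun z => |P.real A - (empiricalDist z).real A|)
      (Measure.pi fun _ : Fin n => P) := by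
  have := measurable_real_empiricalDist (n := n) hA
  refine Integrable.of_bound (C := 1)
    (continuous_abs.measurable.comp (this.const_sub _)).aestronglyMeasurable (.of_forall fun z => ?_)
  have := isProbabilityMeasure_empiricalDist hn z
  have h1 : P.real A ≤ 1 := measureReal_le_one
  have h2 : (empiricalDist z).real A ≤ 1 := measureReal_le_one
  have h3 : 0 ≤ P.real A := measureReal_nonneg
  have h4 : 0 ≤ (empiricalDist z).real A := measureReal_nonneg
  rw [Real.norm_eq_abs, abs_abs, abs_le]
  constructor <;> linarith

/-- The mean deviation of the empirical frequency of an event from its probability. -/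
lemma integral_abs_sub_real_empiricalDist_le {d n : ℕ} (hn : n ≠ 0)
    (P : Measure (EuclideanSpace ℝ (Fin d))) [IsProbabilityMeasure P]
    {A : Set (EuclideanSpace ℝ (Fin d))} (hA : MeasurableSet A) :
    ∫ z, |P.real A - (empiricalDist z).real A| ∂(Measure.pi fun _ : Fin n => P) ≤
      Real.sqrt (P.real A / n) := by
  set π := Measure.pi fun _ : Fin n => P with hπ
  have hn' : (n : ℝ) ≠ 0 := by exact_mod_cast hn
  set W : EuclideanSpace ℝ (Fin d) → ℝ := A.indicator 1 with hW
  have hWm : Measurable W := measurable_one.indicator hA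
  have hWL : MemLp W 2 P := by
    refine MemLp.of_bound hWm.aestronglyMeasurable 1 (.of_forall fun x => ?_)
    by_cases hx : x ∈ A <;> simp [W, hx]
  have hWi : ∀ i : Fin n, MemLp (fun z : Fin n → EuclideanSpace ℝ (Fin d) => W (z i)) 2 π :=
    fun i => hWL.comp_measurePreserving (measurePreserving_eval (fun _ => P) i)
  have hWe : ∫ x, W x ∂P = P.real A := integral_indicator_one hA
  have hmean : ∫ z, (∑ i, W (z i)) ∂π = n * P.real A := by
    rw [integral_finsetSum _ fun i _ => (hWi i).integrable (by norm_num)]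
    have : ∀ i : Fin n, ∫ z, W (z i) ∂π = P.real A := fun i => by
      rw [← hWe]; exact integral_comp_eval hWm.aestronglyMeasurable
    simp [this]
  have hvar : ∫ z, (∑ i, W (z i) - n * P.real A) ^ 2 ∂π ≤ n * P.real A := by
    have h1 := variance_sum_pi (μ := fun _ : Fin n => P) (X := fun _ => W) fun _ => hWL
    have h2 : Var[∑ i, fun ω : Fin n → EuclideanSpace ℝ (Fin d) => W (ω i); π] =
        ∫ z, (∑ i, W (z i) - n * P.real A) ^ 2 ∂π := by
      rw [variance_eq_integral]
      · simp only [Finset.sum_apply, hmean]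
      · exact (Finset.aemeasurable_sum _ fun i _ => (hWi i).aemeasurable)
    rw [← h2, h1, Finset.sum_const, Finset.card_univ, Fintype.card_fin, nsmul_eq_mul]
    gcongr
    -- An indicator equals its own square, so its variance is at most `P A`.
    refine (variance_le_expectation_sq hWm.aestronglyMeasurable).trans_eq ?_
    rw [← hWe]
    refine integral_congr_ae (.of_forall fun x => ?_)
    by_cases hx : x ∈ A <;> simp [W, hx]
  have heq : ∀ z : Fin n → EuclideanSpace ℝ (Fin d),
      P.real A - (empiricalDist z).real A = -(n : ℝ)⁻¹ * (∑ i, W (z i) - n * P.real A) := by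
    intro z
    rw [real_empiricalDist z hA]
    field_simp
    ring
  have hL : MemLp (fun z => P.real A - (empiricalDist z).real A) 2 π := by
    simp_rw [heq]
    refine MemLp.const_mul ?_ _
    exact (memLp_finsetSum _ fun i _ => hWi i).sub (memLp_const _)
  refine (integral_abs_le_sqrt_integral_sq hL).trans (Real.sqrt_le_sqrt ?_)
  simp_rw [heq, mul_pow, integral_const_mul]
  calc (-(n : ℝ)⁻¹) ^ 2 * ∫ z, (∑ i, W (z i) - n * P.real A) ^ 2 ∂π
      ≤ (-(n : ℝ)⁻¹) ^ 2 * (n * P.real A) := by gcongr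
    _ = _ := by field_simp

/-! ### The expected multiscale sum -/

lemma sum_sqrt_le {ι : Type*} (s : Finset ι) {f : ι → ℝ} (hf : ∀ i, 0 ≤ f i) :
    ∑ i ∈ s, Real.sqrt (f i) ≤ Real.sqrt (s.card * ∑ i ∈ s, f i) := by
  refine Real.le_sqrt_of_sq_le ((sq_sum_le_card_mul_sum_sq (f := fun i => √(f i))).trans_eq ?_)
  simp_rw [Real.sq_sqrt (hf _)]

/-- The number of cubes of one shell. -/
lemma card_cube_le (d l : ℕ) :
    ((Fintype.piFinset fun _ : Fin d => Finset.Icc (-2 ^ l : ℤ) (2 ^ l)).card : ℝ) ≤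
      3 ^ d * (2 ^ d) ^ l := by
  have h1 : (2 ^ l + 1 - (-2 ^ l) : ℤ).toNat ≤ 3 * 2 ^ l := by
    have : (1 : ℤ) ≤ 2 ^ l := one_le_pow₀ (by norm_num)
    rw [Int.toNat_le]; push_cast; linarith
  have h2 : (Fintype.piFinset fun _ : Fin d => Finset.Icc (-2 ^ l : ℤ) (2 ^ l)).card ≤
      (3 * 2 ^ l) ^ d := by
    simp only [Fintype.card_piFinset, Int.card_Icc, Finset.prod_const, Finset.card_univ,
      Fintype.card_fin]
    exact Nat.pow_le_pow_left h1 d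
  calc _ ≤ (((3 * 2 ^ l) ^ d : ℕ) : ℝ) := by exact_mod_cast h2
    _ = _ := by push_cast; rw [mul_pow, ← pow_mul, ← pow_mul, mul_comm l d]

lemma sum_real_cell_le {d : ℕ} (M : ℝ) (l j : ℕ) (P : Measure (EuclideanSpace ℝ (Fin d)))
    [IsProbabilityMeasure P] (S : Finset (Fin d → ℤ)) :
    ∑ m ∈ S, P.real (cell M l ⁻¹' {(j, m)}) ≤ P.real (shell M ⁻¹' {j}) := by
  rw [← measureReal_biUnion_finset]
  · refine measureReal_mono (Set.iUnion₂_subset fun m _ z hz => ?_)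
    simp only [Set.mem_preimage, Set.mem_singleton_iff] at hz ⊢
    exact congrArg Prod.fst hz
  · intro m _ m' _ hne
    refine Disjoint.preimage _ (Set.disjoint_singleton.2 fun h => hne (congrArg Prod.snd h))
  · exact fun m _ => measurable_cell M l (measurableSet_singleton _)

/-- Markov's inequality on a shell. -/
lemma two_pow_mul_sqrt_real_shell_succ_le {d : ℕ} {M q : ℝ} (hM : 0 < M) (hq : 0 < q)
    {P : Measure (EuclideanSpace ℝ (Fin d))} [IsProbabilityMeasure P]
    (hi : Integrable (fun z => ‖z‖ ^ q) P) (hPM : ∫ z, ‖z‖ ^ q ∂P ≤ M ^ q) (i : ℕ) :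
    2 ^ (i + 1) * Real.sqrt (P.real (shell M ⁻¹' {i + 1})) ≤ 2 * ((2 : ℝ) ^ (1 - q / 2)) ^ i := by
  have h2 : (0 : ℝ) < 2 ^ i := by positivity
  have h1 : P.real (shell M ⁻¹' {i + 1}) ≤ ((2 : ℝ) ^ i) ^ (-q) := by
    have hsub : shell M ⁻¹' {i + 1} ⊆
        {z : EuclideanSpace ℝ (Fin d) | (2 ^ i * M) ^ q ≤ ‖z‖ ^ q} := by
      intro z hz
      have : ¬ shell M z ≤ i := by
        simp only [Set.mem_preimage, Set.mem_singleton_iff] at hz; omega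
      rw [shell_le_iff hM, not_le] at this
      exact Real.rpow_le_rpow (by positivity) this.le hq.le
    have hmk := mul_meas_ge_le_integral_of_nonneg
      (.of_forall fun z : EuclideanSpace ℝ (Fin d) => Real.rpow_nonneg (norm_nonneg z) q) hi
      ((2 ^ i * M) ^ q)
    have h3 : (2 ^ i * M) ^ q * P.real (shell M ⁻¹' {i + 1}) ≤ M ^ q :=
      (mul_le_mul_of_nonneg_left (measureReal_mono hsub) (by positivity)).trans (hmk.trans hPM)
    rw [Real.mul_rpow h2.le hM.le, mul_right_comm] at h3
    have h4 : ((2 : ℝ) ^ i) ^ q * P.real (shell M ⁻¹' {i + 1}) ≤ 1 := by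
      have : 0 < M ^ q := by positivity
      nlinarith
    rw [Real.rpow_neg h2.le, ← one_div, le_div_iff₀ (by positivity)]
    linarith
  calc 2 ^ (i + 1) * Real.sqrt (P.real (shell M ⁻¹' {i + 1}))
      ≤ 2 ^ (i + 1) * Real.sqrt (((2 : ℝ) ^ i) ^ (-q)) := by gcongr
    _ = 2 * ((2 : ℝ) ^ (1 - q / 2)) ^ i := by
      rw [Real.sqrt_eq_rpow, ← Real.rpow_mul h2.le, pow_succ, mul_comm ((2 : ℝ) ^ i) 2, mul_assoc]
      congr 1
      nth_rewrite 1 [← Real.rpow_one ((2 : ℝ) ^ i)]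
      rw [← Real.rpow_add h2, ← Real.rpow_natCast, ← Real.rpow_natCast, ← Real.rpow_mul (by norm_num),
        ← Real.rpow_mul (by norm_num)]
      congr 1; ring

lemma sum_two_pow_mul_sqrt_real_shell_le {d : ℕ} {M q : ℝ} (hM : 0 < M) (hq : 2 < q)
    {P : Measure (EuclideanSpace ℝ (Fin d))} [IsProbabilityMeasure P]
    (hi : Integrable (fun z => ‖z‖ ^ q) P) (hPM : ∫ z, ‖z‖ ^ q ∂P ≤ M ^ q) (J : ℕ) :
    ∑ j ∈ Finset.range (J + 1), 2 ^ j * Real.sqrt (P.real (shell M ⁻¹' {j})) ≤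
      1 + 2 * (1 - (2 : ℝ) ^ (1 - q / 2))⁻¹ := by
  have hb0 : (0 : ℝ) ≤ (2 : ℝ) ^ (1 - q / 2) := by positivity
  have hb1 : (2 : ℝ) ^ (1 - q / 2) < 1 :=
    Real.rpow_lt_one_of_one_lt_of_neg one_lt_two (by linarith)
  -- Markov's inequality gives nothing on the central ball; its term is at most `1`.
  rw [Finset.sum_range_succ', add_comm]
  gcongr
  · rw [pow_zero, one_mul]
    exact Real.sqrt_le_one.2 measureReal_le_one
  · calc _ ≤ ∑ i ∈ Finset.range J, 2 * ((2 : ℝ) ^ (1 - q / 2)) ^ i :=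
          Finset.sum_le_sum fun i _ =>
            two_pow_mul_sqrt_real_shell_succ_le hM (by linarith) hi hPM i
      _ = 2 * ∑ i ∈ Finset.range J, ((2 : ℝ) ^ (1 - q / 2)) ^ i := by rw [Finset.mul_sum]
      _ ≤ _ := by
        gcongr
        rw [← tsum_geometric_of_lt_one hb0 hb1]
        exact (summable_geometric_of_lt_one hb0 hb1).sum_le_tsum _ fun i _ => by positivity

lemma integrable_cellSum {d n : ℕ} (hn : n ≠ 0) (M : ℝ) (J N : ℕ)
    (P : Measure (EuclideanSpace ℝ (Fin d))) [IsProbabilityMeasure P] :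
    Integrable (fun z => cellSum M J N P (empiricalDist z)) (Measure.pi fun _ : Fin n => P) :=
  integrable_finsetSum _ fun l _ => integrable_finsetSum _ fun _ _ =>
    (integrable_abs_sub_real_empiricalDist hn P
      (measurable_cell M l (measurableSet_singleton _))).const_mul _

lemma integral_cellSum_le {d n : ℕ} (hn : n ≠ 0) {M q : ℝ} (hM : 0 < M) (hq : 2 < q) (J N : ℕ)
    {P : Measure (EuclideanSpace ℝ (Fin d))} [IsProbabilityMeasure P]
    (hi : Integrable (fun z => ‖z‖ ^ q) P) (hPM : ∫ z, ‖z‖ ^ q ∂P ≤ M ^ q) :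
    ∫ z, cellSum M J N P (empiricalDist z) ∂(Measure.pi fun _ : Fin n => P) ≤
      d * M * (1 + 2 * (1 - (2 : ℝ) ^ (1 - q / 2))⁻¹) * Real.sqrt (3 ^ d) / Real.sqrt n *
        ∑ l ∈ Finset.range (N + 1), (Real.sqrt (2 ^ d) / 2) ^ l := by
  have hm : ∀ l a, MeasurableSet (cell M l ⁻¹' {a} : Set (EuclideanSpace ℝ (Fin d))) :=
    fun l a => measurable_cell M l (measurableSet_singleton _)
  have hint : ∀ l a, Integrable (fun z : Fin n → EuclideanSpace ℝ (Fin d) =>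
      d * (2 ^ a.1 * M / 2 ^ l) *
        |P.real (cell M l ⁻¹' {a}) - (empiricalDist z).real (cell M l ⁻¹' {a})|)
      (Measure.pi fun _ : Fin n => P) := fun l a =>
    (integrable_abs_sub_real_empiricalDist hn P (hm l a)).const_mul _
  simp only [cellSum]
  rw [integral_finsetSum _ fun l _ => integrable_finsetSum _ fun a _ => hint l a, Finset.mul_sum]
  refine Finset.sum_le_sum fun l _ => ?_
  rw [integral_finsetSum _ fun a _ => hint l a]
  set p : ℕ → ℝ := fun j => P.real (shell M ⁻¹' {j}) with hp
  calc _ ≤ ∑ a ∈ cells d J l, d * (2 ^ a.1 * M / 2 ^ l) *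
        Real.sqrt (P.real (cell M l ⁻¹' {a}) / n) := by
        refine Finset.sum_le_sum fun a _ => ?_
        rw [integral_const_mul]
        gcongr
        exact integral_abs_sub_real_empiricalDist_le hn P (hm l a)
    _ = ∑ j ∈ Finset.range (J + 1), d * (2 ^ j * M / 2 ^ l) / Real.sqrt n *
        ∑ m ∈ Fintype.piFinset fun _ : Fin d => Finset.Icc (-2 ^ l : ℤ) (2 ^ l),
          Real.sqrt (P.real (cell M l ⁻¹' {(j, m)})) := by
        rw [cells, Finset.sum_product]
        refine Finset.sum_congr rfl fun j _ => ?_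
        rw [Finset.mul_sum]
        refine Finset.sum_congr rfl fun m _ => ?_
        rw [Real.sqrt_div' _ (by positivity)]
        ring
    -- Cauchy–Schwarz within one shell, whose cubes are disjoint and number at most `3 ^ d * (2 ^ d)
    -- ^ l`.
    _ ≤ ∑ j ∈ Finset.range (J + 1), d * (2 ^ j * M / 2 ^ l) / Real.sqrt n *
        Real.sqrt (3 ^ d * (2 ^ d) ^ l * p j) := by
        gcongr with j _
        refine (sum_sqrt_le _ fun m => measureReal_nonneg).trans (Real.sqrt_le_sqrt ?_)
        gcongr
        · exact card_cube_le d l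
        · exact sum_real_cell_le M l j P _
    _ = d * M * Real.sqrt (3 ^ d) / Real.sqrt n * (Real.sqrt (2 ^ d) / 2) ^ l *
        ∑ j ∈ Finset.range (J + 1), 2 ^ j * Real.sqrt (p j) := by
        rw [Finset.mul_sum]
        refine Finset.sum_congr rfl fun j _ => ?_
        have : Real.sqrt ((2 ^ d) ^ l) = Real.sqrt (2 ^ d) ^ l := by
          rw [Real.sqrt_eq_iff_mul_self_eq (by positivity) (by positivity), ← mul_pow,
            Real.mul_self_sqrt (by positivity)]
        rw [Real.sqrt_mul (by positivity), Real.sqrt_mul (by positivity), this, div_pow]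
        ring
    _ ≤ d * M * Real.sqrt (3 ^ d) / Real.sqrt n * (Real.sqrt (2 ^ d) / 2) ^ l *
        (1 + 2 * (1 - (2 : ℝ) ^ (1 - q / 2))⁻¹) := by
        gcongr
        exact sum_two_pow_mul_sqrt_real_shell_le hM hq hi hPM J
    _ = _ := by ring

lemma integral_two_pow_shell_le {d : ℕ} {M q : ℝ} (hM : 0 < M) (hq : 1 ≤ q) {J : ℕ}
    {P : Measure (EuclideanSpace ℝ (Fin d))} [IsProbabilityMeasure P]
    (hP : ∀ᵐ z ∂P, ‖z‖ ≤ 2 ^ J * M)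
    (hi : Integrable (fun z => ‖z‖ ^ q) P) (hPM : ∫ z, ‖z‖ ^ q ∂P ≤ M ^ q) :
    ∫ z, 2 ^ shell M z * M ∂P ≤ 5 * M := by
  have hMq : 0 < M ^ q := by positivity
  have hpt : ∀ z : EuclideanSpace ℝ (Fin d),
      2 ^ shell M z * M ≤ 3 * M + 2 * M / M ^ q * ‖z‖ ^ q := by
    intro z
    -- Outside the ball of radius `M`, the ratio `‖z‖ / M` is at least `1` and so at most its `q`-th
    -- power.
    have h1 : ‖z‖ ≤ M + M / M ^ q * ‖z‖ ^ q := by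
      rcases le_total ‖z‖ M with h | h
      · have : 0 ≤ M / M ^ q * ‖z‖ ^ q := by positivity
        linarith
      · have h2 : ‖z‖ / M ≤ (‖z‖ / M) ^ q :=
          Real.self_le_rpow_of_one_le ((one_le_div hM).2 h) hq
        rw [Real.div_rpow (norm_nonneg _) hM.le, div_le_iff₀ hM] at h2
        have : M / M ^ q * ‖z‖ ^ q = ‖z‖ ^ q / M ^ q * M := by ring
        linarith
    have h3 : 2 * M / M ^ q * ‖z‖ ^ q = 2 * (M / M ^ q * ‖z‖ ^ q) := by ring
    linarith [two_pow_shell_le hM z]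
  calc _ ≤ ∫ z, (3 * M + 2 * M / M ^ q * ‖z‖ ^ q) ∂P :=
        integral_mono (integrable_two_pow_shell hM hP)
          ((integrable_const _).add (hi.const_mul _)) hpt
    _ = 3 * M + 2 * M / M ^ q * ∫ z, ‖z‖ ^ q ∂P := by
        rw [integral_add (integrable_const _) (hi.const_mul _)]
        simp [integral_const_mul]
    _ ≤ 3 * M + 2 * M / M ^ q * M ^ q := by gcongr
    _ = _ := by field_simp; ring

/-- A number of levels that balances the two error terms. -/
lemma exists_level {d n : ℕ} (hd : 3 ≤ d) (hn : 1 ≤ n) :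
    ∃ N : ℕ, 1 / (2 : ℝ) ^ N ≤ 2 * (n : ℝ) ^ (-(1 / (d : ℝ))) ∧
      1 / Real.sqrt n * ∑ l ∈ Finset.range (N + 1), (Real.sqrt (2 ^ d) / 2) ^ l ≤
        Real.sqrt (2 ^ d) / 2 / (Real.sqrt (2 ^ d) / 2 - 1) * (2 * (n : ℝ) ^ (-(1 / (d : ℝ)))) := by
  have hn' : (1 : ℝ) ≤ n := by exact_mod_cast hn
  have hn0 : (0 : ℝ) < n := by linarith
  have hx : (1 : ℝ) ≤ (n : ℝ) ^ (1 / (d : ℝ)) := Real.one_le_rpow hn' (by positivity)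
  -- This `N` satisfies `2 ^ N ≤ n ^ (1 / d) < 2 ^ (N + 1)`.
  obtain ⟨N, hN1, hN2⟩ := exists_nat_pow_near hx one_lt_two
  have hfirst : 1 / (2 : ℝ) ^ N ≤ 2 * (n : ℝ) ^ (-(1 / (d : ℝ))) := by
    rw [Real.rpow_neg hn0.le, ← div_eq_mul_inv, div_le_div_iff₀ (by positivity) (by positivity)]
    rw [pow_succ] at hN2
    linarith
  refine ⟨N, hfirst, ?_⟩
  set a := Real.sqrt (2 ^ d) / 2 with ha
  -- Here `d ≥ 3` is decisive: at `d = 2` the ratio is `1` and the sum would contribute a logarithm.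
  have ha1 : 1 < a := by
    rw [ha, lt_div_iff₀ two_pos, one_mul]
    refine Real.lt_sqrt_of_sq_lt ?_
    calc (2 : ℝ) ^ 2 < 2 ^ 3 := by norm_num
      _ ≤ 2 ^ d := pow_le_pow_right₀ one_le_two hd
  have haN : a ^ N ≤ Real.sqrt n * (1 / 2 ^ N) := by
    rw [ha, div_pow, div_eq_mul_one_div]
    gcongr
    refine Real.le_sqrt_of_sq_le ?_
    rw [← pow_mul, mul_comm N 2, pow_mul, Real.sq_sqrt (by positivity), ← pow_mul, mul_comm d N,
      pow_mul]
    calc ((2 : ℝ) ^ N) ^ d ≤ ((n : ℝ) ^ (1 / (d : ℝ))) ^ d := by gcongr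
      _ = n := by
        rw [← Real.rpow_natCast, ← Real.rpow_mul hn0.le, one_div_mul_cancel, Real.rpow_one]
        exact_mod_cast (by omega : d ≠ 0)
  have ha0 : 0 < a - 1 := by linarith
  have hs : 0 < Real.sqrt n := Real.sqrt_pos.2 hn0
  calc 1 / Real.sqrt n * ∑ l ∈ Finset.range (N + 1), a ^ l
      = 1 / Real.sqrt n * ((a ^ (N + 1) - 1) / (a - 1)) := by rw [geom_sum_eq ha1.ne']
    _ ≤ 1 / Real.sqrt n * (a * (Real.sqrt n * (1 / 2 ^ N)) / (a - 1)) := by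
        gcongr
        rw [pow_succ, mul_comm]
        have := mul_le_mul_of_nonneg_left haN (by linarith : 0 ≤ a)
        linarith
    _ = a / (a - 1) * (1 / 2 ^ N) := by field_simp
    _ ≤ _ := by gcongr

/-- The empirical measure converges at rate `n ^ (-1 / d)` in the transport distance: one
integrable random variable dominates the deviation over all Lipschitz functions. -/
theorem exists_lipschitz_deviation_bound (d : ℕ) (hd : 3 ≤ d) (q : ℝ) (hq : 2 < q) :
    ∃ C : ℝ, 0 ≤ C ∧ ∀ (M : ℝ), 0 < M → ∀ (J : ℕ) (P : Measure (EuclideanSpace ℝ (Fin d))),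
      IsProbabilityMeasure P → (∀ᵐ z ∂P, ‖z‖ ≤ 2 ^ J * M) →
      Integrable (fun z => ‖z‖ ^ q) P → ∫ z, ‖z‖ ^ q ∂P ≤ M ^ q → ∀ n : ℕ, 1 ≤ n →
      ∃ B : (Fin n → EuclideanSpace ℝ (Fin d)) → ℝ, Integrable B (Measure.pi fun _ => P) ∧
        ∫ z, B z ∂(Measure.pi fun _ => P) ≤ C * M * (n : ℝ) ^ (-(1 / (d : ℝ))) ∧
        ∀ z, (∀ i, ‖z i‖ ≤ 2 ^ J * M) → ∀ (K : NNReal) (g : EuclideanSpace ℝ (Fin d) → ℝ),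
          LipschitzWith K g → |∫ x, g x ∂P - ∫ x, g x ∂empiricalDist z| ≤ K * B z := by
  set S := 1 + 2 * (1 - (2 : ℝ) ^ (1 - q / 2))⁻¹ with hS
  set a := Real.sqrt (2 ^ d) / 2 with ha
  have hb1 : (2 : ℝ) ^ (1 - q / 2) < 1 :=
    Real.rpow_lt_one_of_one_lt_of_neg one_lt_two (by linarith)
  have hS0 : 0 ≤ S := by
    have : 0 ≤ (1 - (2 : ℝ) ^ (1 - q / 2))⁻¹ := inv_nonneg.2 (by linarith)
    positivity
  have ha1 : 1 ≤ a := by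
    rw [ha, le_div_iff₀ two_pos, one_mul]
    refine Real.le_sqrt_of_sq_le ?_
    exact pow_le_pow_right₀ one_le_two (by omega)
  have ha0 : 0 ≤ a / (a - 1) := div_nonneg (by linarith) (by linarith)
  -- The `20` is `2 * 10`: `1 / 2 ^ N ≤ 2 * y`, and the mean shell radius, at most `5 * M`, enters
  -- once for `P` and once for the sample.
  refine ⟨d * 20 + d * S * Real.sqrt (3 ^ d) * (a / (a - 1)) * 2, by positivity, ?_⟩
  intro M hM J P _ hP hi hPM n hn
  have hn0 : n ≠ 0 := by omega
  have hn1 : (n : ℝ) ≠ 0 := by exact_mod_cast hn0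
  obtain ⟨N, hN1, hN2⟩ := exists_level hd hn
  set y := (n : ℝ) ^ (-(1 / (d : ℝ))) with hy
  set r : EuclideanSpace ℝ (Fin d) → ℝ := fun z => 2 ^ shell M z * M with hr
  have hri : Integrable r P := integrable_two_pow_shell hM hP
  have hrei : ∀ i : Fin n, Integrable (fun z : Fin n → EuclideanSpace ℝ (Fin d) => r (z i))
      (Measure.pi fun _ => P) := fun i => integrable_comp_eval (μ := fun _ : Fin n => P) hri
  have hrE : Integrable (fun z : Fin n → EuclideanSpace ℝ (Fin d) => ∫ x, r x ∂empiricalDist z)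
      (Measure.pi fun _ => P) := by
    simp_rw [integral_empiricalDist]
    exact (integrable_finsetSum _ fun i _ => hrei i).div_const _
  have hrEe : ∫ z : Fin n → EuclideanSpace ℝ (Fin d), ∫ x, r x ∂empiricalDist z
      ∂(Measure.pi fun _ => P) = ∫ x, r x ∂P := by
    simp_rw [integral_empiricalDist]
    rw [integral_div, integral_finsetSum _ fun i _ => hrei i]
    have : ∀ i : Fin n, ∫ z : Fin n → EuclideanSpace ℝ (Fin d), r (z i) ∂(Measure.pi fun _ => P) =
        ∫ x, r x ∂P := fun i => integral_comp_eval (μ := fun _ : Fin n => P) hri.aestronglyMeasurable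
    simp [this, hn1]
  have hcs := integrable_cellSum hn0 M J N P
  have hrs : Integrable (fun z : Fin n → EuclideanSpace ℝ (Fin d) =>
      d / 2 ^ N * (∫ x, r x ∂P + ∫ x, r x ∂empiricalDist z)) (Measure.pi fun _ => P) :=
    ((integrable_const _).add hrE).const_mul _
  refine ⟨fun z => d / 2 ^ N * (∫ x, r x ∂P + ∫ x, r x ∂empiricalDist z) +
    cellSum M J N P (empiricalDist z), hrs.add hcs, ?_, ?_⟩
  · rw [integral_add hrs hcs, integral_const_mul,
      integral_add (integrable_const _) hrE, hrEe]
    have hr5 : ∫ x, r x ∂P ≤ 5 * M := integral_two_pow_shell_le hM (by linarith) hP hi hPM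
    have hT := integral_cellSum_le hn0 hM hq J N hi hPM
    have h1 : (d : ℝ) / 2 ^ N * (∫ x, r x ∂P + ∫ x, r x ∂P) ≤ d * 20 * M * y := by
      calc (d : ℝ) / 2 ^ N * (∫ x, r x ∂P + ∫ x, r x ∂P)
          = d * (1 / 2 ^ N) * (∫ x, r x ∂P + ∫ x, r x ∂P) := by ring
        _ ≤ d * (1 / 2 ^ N) * (5 * M + 5 * M) := by gcongr
        _ ≤ d * (2 * y) * (5 * M + 5 * M) := by gcongr
        _ = _ := by ring
    have h2 : d * M * S * Real.sqrt (3 ^ d) / Real.sqrt n *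
        ∑ l ∈ Finset.range (N + 1), a ^ l ≤
        d * S * Real.sqrt (3 ^ d) * (a / (a - 1)) * 2 * M * y := by
      calc _ = d * M * S * Real.sqrt (3 ^ d) *
            (1 / Real.sqrt n * ∑ l ∈ Finset.range (N + 1), a ^ l) := by ring
        _ ≤ d * M * S * Real.sqrt (3 ^ d) * (a / (a - 1) * (2 * y)) := by gcongr
        _ = _ := by ring
    simp only [integral_const, probReal_univ, one_smul]
    linarith
  · intro z hz K g hg
    have := isProbabilityMeasure_empiricalDist hn0 z
    exact abs_integral_sub_integral_le hM N hP (ae_empiricalDist hz) hg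

/-! ### The uniform deviation over bounded Lipschitz functions -/

/-- The `K`-Lipschitz functions with values in `[0, b]`. -/
def lipClass (d : ℕ) (K b : NNReal) : Set (EuclideanSpace ℝ (Fin d) → ℝ) :=
  {g | LipschitzWith K g ∧ ∀ x, g x ∈ Set.Icc (0 : ℝ) b}

lemma nonempty_lipClass (d : ℕ) (K b : NNReal) : Nonempty (lipClass d K b) :=
  ⟨⟨fun _ => 0, LipschitzWith.const' 0, fun _ => ⟨le_rfl, b.2⟩⟩⟩

/-- The largest deviation between the mean and the empirical mean over `lipClass d K b`. -/
def deviation {d n : ℕ} (P : Measure (EuclideanSpace ℝ (Fin d))) (K b : NNReal)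
    (z : Fin n → EuclideanSpace ℝ (Fin d)) : ℝ :=
  ⨆ g : lipClass d K b, |∫ x, g.1 x ∂P - ∫ x, g.1 x ∂empiricalDist z|

lemma integral_mem_Icc_of_mem_lipClass {d : ℕ} {K b : NNReal}
    {g : EuclideanSpace ℝ (Fin d) → ℝ} (hg : g ∈ lipClass d K b)
    (Q : Measure (EuclideanSpace ℝ (Fin d))) [IsProbabilityMeasure Q] :
    ∫ x, g x ∂Q ∈ Set.Icc (0 : ℝ) b := by
  refine ⟨integral_nonneg fun x => (hg.2 x).1, ?_⟩
  refine (integral_mono_of_nonneg (.of_forall fun x => (hg.2 x).1) (integrable_const (b : ℝ))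
    (.of_forall fun x => (hg.2 x).2)).trans (by simp)

lemma deviation_nonneg {d n : ℕ} {P : Measure (EuclideanSpace ℝ (Fin d))} {K b : NNReal}
    (z : Fin n → EuclideanSpace ℝ (Fin d)) : 0 ≤ deviation P K b z :=
  Real.iSup_nonneg fun _ => abs_nonneg _

section

variable {d n : ℕ} {P : Measure (EuclideanSpace ℝ (Fin d))} [IsProbabilityMeasure P] {K b : NNReal}

lemma abs_integral_sub_le_of_mem_lipClass (hn : n ≠ 0) {g : EuclideanSpace ℝ (Fin d) → ℝ}
    (hg : g ∈ lipClass d K b) (z : Fin n → EuclideanSpace ℝ (Fin d)) :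
    |∫ x, g x ∂P - ∫ x, g x ∂empiricalDist z| ≤ b := by
  have := isProbabilityMeasure_empiricalDist hn z
  have h1 := integral_mem_Icc_of_mem_lipClass hg P
  have h2 := integral_mem_Icc_of_mem_lipClass hg (empiricalDist z)
  rw [abs_le]
  constructor <;> linarith [h1.1, h1.2, h2.1, h2.2]

lemma bddAbove_deviation (hn : n ≠ 0) (z : Fin n → EuclideanSpace ℝ (Fin d)) :
    BddAbove (Set.range fun g : lipClass d K b =>
      |∫ x, g.1 x ∂P - ∫ x, g.1 x ∂empiricalDist z|) :=
  ⟨b, by rintro _ ⟨g, rfl⟩; exact abs_integral_sub_le_of_mem_lipClass hn g.2 z⟩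

lemma le_deviation (hn : n ≠ 0) {g : EuclideanSpace ℝ (Fin d) → ℝ} (hg : g ∈ lipClass d K b)
    (z : Fin n → EuclideanSpace ℝ (Fin d)) :
    |∫ x, g x ∂P - ∫ x, g x ∂empiricalDist z| ≤ deviation P K b z :=
  le_ciSup (bddAbove_deviation (P := P) hn z) (⟨g, hg⟩ : lipClass d K b)

lemma deviation_le (hn : n ≠ 0) (z : Fin n → EuclideanSpace ℝ (Fin d)) :
    deviation P K b z ≤ b :=
  have := nonempty_lipClass d K b
  ciSup_le fun g => abs_integral_sub_le_of_mem_lipClass hn g.2 z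

lemma norm_deviation_le (hn : n ≠ 0) (z : Fin n → EuclideanSpace ℝ (Fin d)) :
    ‖deviation P K b z‖ ≤ b := by
  rw [Real.norm_of_nonneg (deviation_nonneg z)]
  exact deviation_le hn z

/-- The class is uncountable, but a supremum of continuous functions of the sample is lower
semicontinuous. -/
lemma measurable_deviation (hn : n ≠ 0) :
    Measurable (deviation P K b : (Fin n → EuclideanSpace ℝ (Fin d)) → ℝ) := by
  refine LowerSemicontinuous.measurable ?_
  refine lowerSemicontinuous_ciSup (fun z => bddAbove_deviation hn z) fun g => ?_
  refine Continuous.lowerSemicontinuous ?_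
  simp_rw [integral_empiricalDist]
  have := g.2.1.continuous
  fun_prop

/-- Only one summand of the empirical mean changes, and both its values lie in `[0, b]`. -/
lemma deviation_update_le (hn : n ≠ 0) (i : Fin n) (z : Fin n → EuclideanSpace ℝ (Fin d))
    (y : EuclideanSpace ℝ (Fin d)) :
    deviation P K b (Function.update z i y) ≤ deviation P K b z + b / n := by
  have := nonempty_lipClass d K b
  refine ciSup_le fun g => ?_
  have hn' : (0 : ℝ) < n := by exact_mod_cast Nat.pos_of_ne_zero hn
  have h1 := le_deviation (P := P) hn g.2 z
  have h2 : ∑ j, g.1 (Function.update z i y j) - ∑ j, g.1 (z j) = g.1 y - g.1 (z i) := by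
    rw [← Finset.sum_sub_distrib, Finset.sum_eq_single i]
    · simp
    · intro j _ hj
      simp [Function.update_of_ne hj]
    · simp
  have h3 : |∫ x, g.1 x ∂empiricalDist z - ∫ x, g.1 x ∂empiricalDist (Function.update z i y)| ≤
      b / n := by
    rw [integral_empiricalDist, integral_empiricalDist, abs_sub_comm, ← sub_div, h2, abs_div,
      abs_of_pos hn']
    gcongr
    rw [abs_le]
    have h4 := g.2.2 y
    have h5 := g.2.2 (z i)
    constructor <;> linarith [h4.1, h4.2, h5.1, h5.2]
  exact (abs_sub_le _ _ _).trans (add_le_add h1 h3)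

lemma abs_deviation_update_sub_le (hn : n ≠ 0) (i : Fin n)
    (z : Fin n → EuclideanSpace ℝ (Fin d)) (y : EuclideanSpace ℝ (Fin d)) :
    |deviation P K b (Function.update z i y) - deviation P K b z| ≤ (b / n : NNReal) := by
  have h1 := deviation_update_le (P := P) (K := K) (b := b) hn i z y
  have h2 := deviation_update_le (P := P) (K := K) (b := b) hn i (Function.update z i y) (z i)
  rw [Function.update_idem, Function.update_eq_self] at h2
  rw [abs_le]; push_cast
  constructor <;> linarith

/-- The uniform deviation is concentrated around its mean. -/
theorem ofReal_le_measure_deviation_le (hn : n ≠ 0) {δ : ℝ} (hδ : 0 < δ) (hδ1 : δ < 1) :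
    ENNReal.ofReal (1 - δ) ≤ (Measure.pi fun _ : Fin n => P)
      {z | deviation P K b z ≤ ∫ y, deviation P K b y ∂(Measure.pi fun _ : Fin n => P) +
        b * Real.sqrt (2 * Real.log (1 / δ) / n)} := by
  set π := Measure.pi fun _ : Fin n => P
  set m := ∫ y, deviation P K b y ∂π
  set t := (b : ℝ) * Real.sqrt (2 * Real.log (1 / δ) / n) with ht
  have hn' : (0 : ℝ) < n := by exact_mod_cast Nat.pos_of_ne_zero hn
  have hlog : 0 < Real.log (1 / δ) := Real.log_pos (one_lt_one_div hδ hδ1)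
  have ht0 : 0 ≤ t := by positivity
  have hm0 : 0 ≤ m := integral_nonneg fun z => deviation_nonneg z
  -- For `b = 0` the variance proxy in the tail exponent vanishes, so this trivial case is treated
  -- apart.
  rcases eq_or_ne b 0 with hb | hb
  · have : {z : Fin n → EuclideanSpace ℝ (Fin d) | deviation P K b z ≤ m + t} = Set.univ := by
      refine Set.eq_univ_of_forall fun z => ?_
      have := deviation_le (P := P) (K := K) (b := b) hn z
      rw [hb, NNReal.coe_zero, ← hb] at this
      exact this.trans (by positivity)
    rw [this, measure_univ, ENNReal.ofReal_le_one]
    linarith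
  · have hb' : (0 : ℝ) < b := by exact_mod_cast pos_iff_ne_zero.2 hb
    have hsub := hasSubgaussianMGF_of_bounded_differences P (b / n) b n (deviation P K b)
      (measurable_deviation hn) (norm_deviation_le hn) (abs_deviation_update_sub_le hn)
    have h1 := hsub.measure_ge_le ht0
    have h2 : -t ^ 2 / (2 * ((n * (b / n / 2) ^ 2 : NNReal) : ℝ)) = -4 * Real.log (1 / δ) := by
      rw [ht, mul_pow, Real.sq_sqrt (by positivity)]
      push_cast
      field_simp
      ring
    have h3 : Real.exp (-4 * Real.log (1 / δ)) ≤ δ := by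
      rw [one_div, Real.log_inv]
      have h4 : -4 * -Real.log δ ≤ Real.log δ := by
        have := Real.log_neg hδ hδ1
        linarith
      exact (Real.exp_le_exp.2 h4).trans_eq (Real.exp_log hδ)
    rw [h2] at h1
    have hS : MeasurableSet {z : Fin n → EuclideanSpace ℝ (Fin d) | deviation P K b z ≤ m + t} :=
      measurableSet_le (measurable_deviation hn) measurable_const
    have h5 : π.real {z | deviation P K b z ≤ m + t}ᶜ ≤ δ := by
      refine (measureReal_mono fun z hz => ?_).trans (h1.trans h3)
      simp only [Set.mem_compl_iff, Set.mem_ofPred_eq, not_le] at hz ⊢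
      linarith
    rw [probReal_compl_eq_one_sub hS] at h5
    rw [← ofReal_measureReal]
    exact ENNReal.ofReal_le_ofReal (by linarith)

end

/-- The mean of the uniform deviation decays at the rate `n ^ (-1 / d)`. -/
theorem exists_integral_deviation_le (d : ℕ) (hd : 3 ≤ d) (q : ℝ) (hq : 2 < q) :
    ∃ C : ℝ, ∀ (Z : Set (EuclideanSpace ℝ (Fin d))), Bornology.IsBounded Z →
      ∀ (P : Measure (EuclideanSpace ℝ (Fin d))), IsProbabilityMeasure P →
      (∀ᵐ z ∂P, z ∈ Z) → ∀ (n : ℕ), 1 ≤ n → ∀ K b : NNReal,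
      ∫ z, deviation P K b z ∂(Measure.pi fun _ : Fin n => P) ≤
        K * (C * (∫ z, ‖z‖ ^ q ∂P) ^ (1 / q) * (n : ℝ) ^ (-(1 / (d : ℝ)))) := by
  obtain ⟨C, -, hC⟩ := exists_lipschitz_deviation_bound d hd q hq
  refine ⟨C, fun Z hZ P _ hPZ n hn K b => ?_⟩
  have hn0 : n ≠ 0 := by omega
  have hq0 : 0 < q := by linarith
  obtain ⟨R, hR⟩ := hZ.exists_norm_le
  have hi : Integrable (fun z => ‖z‖ ^ q) P := by
    refine Integrable.of_bound (measurable_norm.pow_const q).aestronglyMeasurable (R ^ q) ?_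
    filter_upwards [hPZ] with z hz
    rw [Real.norm_of_nonneg (by positivity)]
    exact Real.rpow_le_rpow (norm_nonneg _) (hR z hz) hq0.le
  set m := ∫ z, ‖z‖ ^ q ∂P with hm
  have hm0 : 0 ≤ m := integral_nonneg fun z => by positivity
  -- The multiscale bound needs `M > 0`, whereas the moment may vanish; `M` therefore decreases to
  -- `m ^ (1 / q)`.
  have hcont : Filter.Tendsto (fun M : ℝ => K * (C * M * (n : ℝ) ^ (-(1 / (d : ℝ)))))
      (nhdsWithin (m ^ (1 / q)) (Set.Ioi (m ^ (1 / q))))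
      (nhds (K * (C * m ^ (1 / q) * (n : ℝ) ^ (-(1 / (d : ℝ)))))) :=
    (Continuous.tendsto (by fun_prop) _).mono_left nhdsWithin_le_nhds
  refine ge_of_tendsto hcont ?_
  filter_upwards [self_mem_nhdsWithin] with M hM
  rw [Set.mem_Ioi] at hM
  have hM0 : 0 < M := (by positivity : 0 ≤ m ^ (1 / q)).trans_lt hM
  have hmM : m ≤ M ^ q := by
    have h := Real.rpow_le_rpow (by positivity) hM.le hq0.le
    rwa [← Real.rpow_mul hm0, one_div_mul_cancel hq0.ne', Real.rpow_one] at h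
  -- The number of shells depends on `Z` and `M`, but `C` does not depend on `J`.
  obtain ⟨J, hJ⟩ := pow_unbounded_of_one_lt (R / M) one_lt_two
  rw [div_lt_iff₀ hM0] at hJ
  have hRJ : ∀ᵐ z ∂P, ‖z‖ ≤ 2 ^ J * M := hPZ.mono fun z hz => (hR z hz).trans hJ.le
  obtain ⟨B, hBi, hBm, hB⟩ := hC M hM0 J P inferInstance hRJ hi hmM n hn
  have hall : ∀ᵐ z ∂(Measure.pi fun _ : Fin n => P), ∀ i, ‖z i‖ ≤ 2 ^ J * M :=
    ae_all_iff.2 fun i =>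
      (measurePreserving_eval (fun _ : Fin n => P) i).quasiMeasurePreserving.ae hRJ
  calc _ ≤ ∫ z, K * B z ∂(Measure.pi fun _ : Fin n => P) := by
        refine integral_mono_of_nonneg (.of_forall fun z => deviation_nonneg z)
          (hBi.const_mul _) ?_
        filter_upwards [hall] with z hz
        have := nonempty_lipClass d K b
        exact ciSup_le fun g => hB z hz K g.1 g.2.1
    _ ≤ _ := by
        rw [integral_const_mul]
        gcongr

/-! ### The reconstruction error -/

section

variable {k d : ℕ} {H : Set (EuclideanSpace ℝ (Fin k))} {Z : Set (EuclideanSpace ℝ (Fin d))}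
  {f : H → EuclideanSpace ℝ (Fin d)}

lemma minError_le (f : H → EuclideanSpace ℝ (Fin d)) (z : EuclideanSpace ℝ (Fin d)) (h : H) :
    minError f z ≤ ‖z - f h‖ ^ 2 :=
  ciInf_le ⟨0, by rintro _ ⟨h, rfl⟩; positivity⟩ h

lemma IsAdmissible.norm_sub_le_diam (hf : IsAdmissible H Z f) (hZ : Bornology.IsBounded Z)
    {z : EuclideanSpace ℝ (Fin d)} (hz : z ∈ Z) (h : H) : ‖z - f h‖ ≤ Metric.diam Z := by
  rw [← dist_eq_norm]
  exact Metric.dist_le_diam_of_mem hZ hz (hf.mem h)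

lemma IsAdmissible.minError_mem_Icc (hf : IsAdmissible H Z f) (hZ : Bornology.IsBounded Z)
    {z : EuclideanSpace ℝ (Fin d)} (hz : z ∈ Z) :
    minError f z ∈ Set.Icc (0 : ℝ) (Metric.diam Z ^ 2) := by
  refine ⟨Real.iInf_nonneg fun h => by positivity, ?_⟩
  obtain ⟨h, -⟩ := hf.exists_min z hz
  refine (minError_le f z h).trans ?_
  gcongr
  exact hf.norm_sub_le_diam hZ hz h

/-- A minimizer for `y` competes at `x`; factoring the difference of squares leaves `dist x y` times
a sum of two norms, each at most `diam Z`. -/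
lemma IsAdmissible.lipschitzOnWith_minError (hf : IsAdmissible H Z f)
    (hZ : Bornology.IsBounded Z) :
    LipschitzOnWith (2 * ⟨Metric.diam Z, Metric.diam_nonneg⟩) (minError f) Z := by
  refine LipschitzOnWith.of_le_add_mul _ fun x hx y hy => ?_
  obtain ⟨h, hmin⟩ := hf.exists_min y hy
  have : Nonempty H := ⟨h⟩
  have h1 : ‖y - f h‖ ^ 2 ≤ minError f y := le_ciInf hmin
  have h2 := minError_le f x h
  have h3 := hf.norm_sub_le_diam hZ hx h
  have h4 := hf.norm_sub_le_diam hZ hy h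
  have h5 : ‖x - f h‖ ≤ dist x y + ‖y - f h‖ := by
    rw [dist_eq_norm]; exact norm_sub_le_norm_sub_add_norm_sub _ _ _
  have h6 : ‖x - f h‖ ^ 2 - ‖y - f h‖ ^ 2 ≤ 2 * Metric.diam Z * dist x y := by
    have h7 : (‖x - f h‖ - ‖y - f h‖) * (‖x - f h‖ + ‖y - f h‖) ≤
        dist x y * (‖x - f h‖ + ‖y - f h‖) := by
      gcongr
      linarith
    have h8 : dist x y * (‖x - f h‖ + ‖y - f h‖) ≤ dist x y * (Metric.diam Z + Metric.diam Z) := by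
      gcongr
    linarith
  have h9 : ((2 * ⟨Metric.diam Z, Metric.diam_nonneg⟩ : NNReal) : ℝ) = 2 * Metric.diam Z := rfl
  rw [h9]
  linarith

/-- On the data set, the reconstruction error agrees with a bounded Lipschitz function. -/
lemma IsAdmissible.exists_mem_lipClass (hf : IsAdmissible H Z f) (hZ : Bornology.IsBounded Z) :
    ∃ g ∈ lipClass d (2 * ⟨Metric.diam Z, Metric.diam_nonneg⟩)
      (⟨Metric.diam Z, Metric.diam_nonneg⟩ ^ 2), Set.EqOn (minError f) g Z := by
  obtain ⟨g, hg, hgZ⟩ := (hf.lipschitzOnWith_minError hZ).extend_real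
  -- The Lipschitz extension may leave the range off `Z`. Clipping keeps the constant and the values
  -- on `Z`, and gives the global bounds that bounded differences require.
  refine ⟨fun x => max 0 (min (Metric.diam Z ^ 2) (g x)),
    ⟨(hg.const_min _).const_max _, fun x => ⟨le_max_left _ _, ?_⟩⟩, fun z hz => ?_⟩
  · exact max_le (by positivity) (min_le_left _ _)
  · have h := hf.minError_mem_Icc hZ hz
    rw [hgZ hz] at h ⊢
    simp only
    rw [min_eq_right h.2, max_eq_right h.1]

end

lemma genError_le_deviation {k d n : ℕ} (hn : n ≠ 0) {H : Set (EuclideanSpace ℝ (Fin k))}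
    {Z : Set (EuclideanSpace ℝ (Fin d))} (hZ : Bornology.IsBounded Z)
    {P : Measure (EuclideanSpace ℝ (Fin d))} [IsProbabilityMeasure P] (hPZ : ∀ᵐ z ∂P, z ∈ Z)
    {F : Set (H → EuclideanSpace ℝ (Fin d))} (hF : ∀ f ∈ F, IsAdmissible H Z f)
    {z : Fin n → EuclideanSpace ℝ (Fin d)} (hz : ∀ i, z i ∈ Z) :
    genError P F z ≤ ENNReal.ofReal (deviation P (2 * ⟨Metric.diam Z, Metric.diam_nonneg⟩)
      (⟨Metric.diam Z, Metric.diam_nonneg⟩ ^ 2) z) := by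
  refine iSup₂_le fun f hf => ENNReal.ofReal_le_ofReal ?_
  obtain ⟨g, hg, hgZ⟩ := (hF f hf).exists_mem_lipClass hZ
  have h1 : risk P f = ∫ x, g x ∂P := integral_congr_ae (hPZ.mono fun x hx => hgZ hx)
  have h2 : risk (empiricalDist z) f = ∫ x, g x ∂empiricalDist z :=
    integral_congr_ae ((ae_empiricalDist hz).mono fun x hx => hgZ hx)
  rw [h1, h2]
  exact le_deviation hn hg z

end CodingScheme

end

/-! ### Assembly of the generalization bound -/

theorem mainTheorem1 (d : ℕ) (hd : 3 ≤ d) (q : ℝ) (hq : 2 < q) :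
    ∃ C : ℝ, ∀ (Z : Set (EuclideanSpace ℝ (Fin d))), Bornology.IsBounded Z →
      ∀ (P : Measure (EuclideanSpace ℝ (Fin d))), IsProbabilityMeasure P →
      (∀ᵐ z ∂P, z ∈ Z) →
      ∀ (k : ℕ) (H : Set (EuclideanSpace ℝ (Fin k))), IsCompact H →
      ∀ (F : Set (H → EuclideanSpace ℝ (Fin d))), (∀ f ∈ F, CodingScheme.IsAdmissible H Z f) →
      ∀ (n : ℕ), 1 ≤ n →
      ∀ (Ω : Type*) (mΩ : MeasurableSpace Ω) (μ : Measure Ω), IsProbabilityMeasure μ →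
      ∀ (X : Fin n → Ω → EuclideanSpace ℝ (Fin d)), (∀ i, HasLaw (X i) P μ) → iIndepFun X μ →
      ∀ (δ : ℝ), 0 < δ → δ < 1 →
        ENNReal.ofReal (1 - δ) ≤
          μ {ω | CodingScheme.genError P F (fun i => X i ω) ≤
            ENNReal.ofReal
              (C * Metric.diam Z * (∫ z, ‖z‖ ^ q ∂P) ^ (1 / q) * (n : ℝ) ^ (-(1 / (d : ℝ)))
                + Metric.diam Z ^ 2 * Real.sqrt (2 * Real.log (1 / δ) / n))} := by

  obtain ⟨C, hC⟩ := CodingScheme.exists_integral_deviation_le d hd q hq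
  -- The factor `2` comes from the Lipschitz constant `2 * diam Z`.
  refine ⟨2 * C, ?_⟩
  intro Z hZ P _ hPZ k H _ F hF n hn Ω _ μ _ X hX hind δ hδ hδ1
  have hn0 : n ≠ 0 := by omega
  set D : NNReal := ⟨Metric.diam Z, Metric.diam_nonneg⟩
  have hXm : ∀ i, AEMeasurable (X i) μ := fun i => (hX i).aemeasurable
  have hlaw : μ.map (fun ω i => X i ω) = Measure.pi fun _ => P := by
    rw [(iIndepFun_iff_map_fun_eq_pi_map hXm).1 hind]
    simp_rw [(hX _).map_eq]
  have hXZ : ∀ᵐ ω ∂μ, ∀ i, X i ω ∈ Z := ae_all_iff.2 fun i =>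
    ae_of_ae_map (hXm i) (by rwa [(hX i).map_eq])
  have hconc := CodingScheme.ofReal_le_measure_deviation_le (P := P) (K := 2 * D) (b := D ^ 2) hn0
    hδ hδ1
  rw [← hlaw, Measure.map_apply_of_aemeasurable (aemeasurable_pi_lambda _ hXm)
    (measurableSet_le (CodingScheme.measurable_deviation hn0) measurable_const)] at hconc
  -- Monotonicity of the measure suffices, so `genError` need not be measurable.
  refine hconc.trans (measure_mono_ae ?_)
  filter_upwards [hXZ] with ω hω hdev
  refine (CodingScheme.genError_le_deviation hn0 hZ hPZ hF hω).trans
    (ENNReal.ofReal_le_ofReal ?_)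
  have hmean := hC Z hZ P inferInstance hPZ n hn (2 * D) (D ^ 2)
  have hdev' := Set.mem_ofPred_eq.mp hdev
  have hD : (D : ℝ) = Metric.diam Z := rfl
  rw [hlaw] at hdev'
  push_cast at hdev' hmean
  rw [hD] at hdev' hmean
  linarith
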